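/- Let $n\in\mathbb N$, let $f_1,\dots,f_n\in\mathbb R[t,x]$ with $x=(x_1,\dots,x_n)$, let $T>0$, and let $g_X,g_T\in\mathbb R[x]$. Put \[ X=\{x\in\mathbb R^n: g_X(x)>0\},\quad \bar X=\{x: g_X(x)\ge 0\},\quad X_\partial=\{x: g_X(x)=0\}, \] \[ X_T=\{x: g_T(x)>0\},\quad X_T^c=\{x: g_X(x)\ge 0,\ g_T(x)\le 0\}, \] and assume that $X$ is nonempty, $\bar X$ is compact and $X_T\subset X$. For a compact set $K$, let $M(K)$ be the space of finite signed Borel measures with support contained in $K$ and $C(K)$ the space of continuous real functions on $K$. Let $C^1([0,T]\times\bar X)$ be the class of continuously differentiable functions on $[0,T]\times\bar X$, understood as functions given by a $C^1$ function $v$ on $\mathbb R\times\mathbb R^n$; for such $v$ let \[ \mathcal Lv=\frac{\partial v}{\partial t}+\operatorname{grad}_x v\cdot f . \] Let $\lambda$ be the Lebesgue measure on $\mathbb R^n$. Consider the primal linear program \[ p^*=\sup \int 1\,d\mu_0 \] over all nonnegative measures $\mu_0\in M(\bar X)$, $\mu\in M([0,T]\times\bar X)$, $\mu_T^1\in M([0,T]\times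 X_\partial)$, $\mu_T^2\in M(X_T^c)$, $\hat\mu_0\in M(\bar X)$ such that \[ \int v\,d\mu_T^1+\int v(T,\cdot)\,d\mu_T^2-\int v(0,\cdot)\,d\mu_0=\int\mathcal Lv\,d\mu\qquad\forall v\in C^1([0,T]\times\bar X), \] \[ \int w\,d\mu_0+\int w\,d\hat\mu_0=\int_{\bar X} w\,d\lambda\qquad\forall w\in C(\bar X), \] and the dual linear program \[ d^*=\inf\int_X w\,d\lambda \] over all $(v,w)\in C^1([0,T]\times\bar X)\times C(\bar X)$ such that \[ \mathcal Lv(t,x)\le 0\ \ \forall (t,x)\in[0,T]\times\bar X,\qquad w(x)\ge v(0,x)+1\ \ \forall x\in\bar X,\qquad w(x)\ge 0\ \ \forall x\in\bar X, \] \[ v(T,x)\ge 0\ \ \forall x\in X_T^c,\qquad v(t,x)\ge 0\ \ \forall (t,x)\in[0,T]\times X_\partial . \] Then there is no duality gap between the two programs, that is, $p^*=d^*$. -/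

import Mathlib

open MeasureTheory Set

noncomputable section

/-- The data of the region-of-attraction problem for the polynomial system `x' = f (t, x)` on
`[0, T]`: the final time, the polynomial vector field (variable `0` is the time `t`, variable
`i + 1` is the coordinate `x i`), and the polynomials `gX`, `gT` describing the constraint set and
the target set. This holds data only; all assumptions on it are hypotheses of the theorem. -/
structure ROAData (n : ℕ) where
  T : ℝ
  f : Fin n → MvPolynomial (Fin (n + 1)) ℝ
  gX : MvPolynomial (Fin n) ℝ
  gT : MvPolynomial (Fin n) ℝ

namespace ROAData

variable {n : ℕ} (P : ROAData n)

/-- The vector field `f (t, x)`. -/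
def field (t : ℝ) (x : EuclideanSpace ℝ (Fin n)) : EuclideanSpace ℝ (Fin n) :=
  WithLp.toLp 2 fun i => MvPolynomial.eval (Fin.cons t (fun j => x j) : Fin (n + 1) → ℝ) (P.f i)

/-- The open constraint set `X = {g_X > 0}`. -/
def X : Set (EuclideanSpace ℝ (Fin n)) :=
  {x | 0 < MvPolynomial.eval (fun j => x j) P.gX}

/-- The closed set `{g_X ≥ 0}` (in general larger than the closure of `X`). -/
def Xbar : Set (EuclideanSpace ℝ (Fin n)) :=
  {x | 0 ≤ MvPolynomial.eval (fun j => x j) P.gX}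

/-- The set `{g_X = 0}`. -/
def Xbdry : Set (EuclideanSpace ℝ (Fin n)) :=
  {x | MvPolynomial.eval (fun j => x j) P.gX = 0}

/-- The open target set `X_T = {g_T > 0}`. -/
def XT : Set (EuclideanSpace ℝ (Fin n)) :=
  {x | 0 < MvPolynomial.eval (fun j => x j) P.gT}

/-- The closed set `X_T^c = {g_X ≥ 0, g_T ≤ 0}`. -/
def XTc : Set (EuclideanSpace ℝ (Fin n)) :=
  {x | 0 ≤ MvPolynomial.eval (fun j => x j) P.gX ∧ MvPolynomial.eval (fun j => x j) P.gT ≤ 0}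

/-- The operator `L v = ∂v/∂t + grad v · f`. Elements of `C¹([0,T] × Xbar)` are represented by
`C¹` functions `v` on the whole of `ℝ × ℝⁿ`. -/
def liouville (v : ℝ × EuclideanSpace ℝ (Fin n) → ℝ) (p : ℝ × EuclideanSpace ℝ (Fin n)) : ℝ :=
  fderiv ℝ v p (1, 0) + fderiv ℝ v p (0, P.field p.1 p.2)

end ROAData

/-- `μ` is a nonnegative element of `M(K)`: a finite Borel measure with support contained
in `K`. -/
def IsNonnegMeasureOn {α : Type*} [TopologicalSpace α] [MeasurableSpace α]
    (K : Set α) (μ : Measure α) : Prop :=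
  IsFiniteMeasure μ ∧ μ.support ⊆ K

namespace ROAData

variable {n : ℕ} (P : ROAData n)

/-- Feasibility of `(μ₀, μ, μ_T¹, μ_T², μ̂₀)` in the primal linear program. -/
structure PrimalFeasible
    (μ₀ : Measure (EuclideanSpace ℝ (Fin n)))
    (μ : Measure (ℝ × EuclideanSpace ℝ (Fin n)))
    (μT1 : Measure (ℝ × EuclideanSpace ℝ (Fin n)))
    (μT2 : Measure (EuclideanSpace ℝ (Fin n)))
    (μhat₀ : Measure (EuclideanSpace ℝ (Fin n))) : Prop where
  initial : IsNonnegMeasureOn P.Xbar μ₀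
  occupation : IsNonnegMeasureOn (Icc 0 P.T ×ˢ P.Xbar) μ
  final₁ : IsNonnegMeasureOn (Icc 0 P.T ×ˢ P.Xbdry) μT1
  final₂ : IsNonnegMeasureOn P.XTc μT2
  slack : IsNonnegMeasureOn P.Xbar μhat₀
  liouville_eq : ∀ v : ℝ × EuclideanSpace ℝ (Fin n) → ℝ, ContDiff ℝ 1 v →
    (∫ p, v p ∂μT1) + (∫ x, v (P.T, x) ∂μT2) - (∫ x, v (0, x) ∂μ₀) =
      ∫ p, P.liouville v p ∂μ
  domination : ∀ w : EuclideanSpace ℝ (Fin n) → ℝ, ContinuousOn w P.Xbar →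
    (∫ x in P.Xbar, w x ∂μ₀) + (∫ x in P.Xbar, w x ∂μhat₀) = ∫ x in P.Xbar, w x ∂volume

/-- The optimal value `p*` of the primal linear program. -/
def primalValue : EReal :=
  sSup {r : EReal | ∃ μ₀ μ μT1 μT2 μhat₀, P.PrimalFeasible μ₀ μ μT1 μT2 μhat₀ ∧
    r = ((∫ _x, (1 : ℝ) ∂μ₀ : ℝ) : EReal)}

/-- Feasibility of `(v, w)` in the dual linear program. -/
structure DualFeasible (v : ℝ × EuclideanSpace ℝ (Fin n) → ℝ)
    (w : EuclideanSpace ℝ (Fin n) → ℝ) : Prop where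
  contDiff : ContDiff ℝ 1 v
  continuousOn : ContinuousOn w P.Xbar
  liouville_nonpos : ∀ t ∈ Icc 0 P.T, ∀ x ∈ P.Xbar, P.liouville v (t, x) ≤ 0
  initial : ∀ x ∈ P.Xbar, v (0, x) + 1 ≤ w x
  final₂ : ∀ x ∈ P.XTc, 0 ≤ v (P.T, x)
  final₁ : ∀ t ∈ Icc 0 P.T, ∀ x ∈ P.Xbdry, 0 ≤ v (t, x)
  nonneg : ∀ x ∈ P.Xbar, 0 ≤ w x

/-- The optimal value `d*` of the dual linear program. -/
def dualValue : EReal :=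
  sInf {r : EReal | ∃ v w, P.DualFeasible v w ∧ r = ((∫ x in P.X, w x : ℝ) : EReal)}

end ROAData

end

/-!
The absence of a duality gap is an instance of conic linear programming duality.

Write the dual program as: minimise `∫ w` over pairs `u = (v, w)` subject to `b ≤ A u`, where
`A (v, w) = (-L v, w - v (0, ·), v (T, ·), v, w)` (`ROAData.constraintMap`) takes values in the
product of the spaces of continuous functions on the five compact sets carrying the primal
measures, and `b = (0, 1, 0, 0, 0)`. Since `∂v/∂t = -M` for `v = M (T + 1 - t)`, suitable pairs
`(v, w)` make `A (v, w)` larger than any prescribed element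
(`ROAData.exists_le_constraintMap`). This Slater condition lets the M. Riesz extension theorem
produce a positive functional `φ` with `φ ∘ A = ∫ w` and `φ b = d*`
(`exists_nonneg_linearMap_of_isGLB`). By the Riesz-Markov-Kakutani theorem the five components of
`φ` are finite measures, and the two properties of `φ` say exactly that these are feasible for the
primal program with value `d*` (`ROAData.exists_primalFeasible`). In particular the primal optimum
is attained.

The other inequality is weak duality (`ROAData.weak_duality`). It bounds the primal value by
`∫ w` over `{g_X ≥ 0}`, whereas the dual objective integrates over `{g_X > 0}`. The two integrals
agree because the zero set of a nonzero polynomial is Lebesgue null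
(`volume_mvPolynomial_zeroSet`).
-/

/-! ### Conic linear programming duality -/

open scoped CompactlySupported

/-- Strong duality for the conic program `inf {c u | b ≤ A u}`: if every element of `F` is dominated
by some `A u`, then the dual program has an optimal solution `φ`, with value the infimum `d`.
The functional `φ` comes from the M. Riesz extension theorem on `(U × ℝ) × F`, applied to the cone
`{((u, r), y) | 0 ≤ A u - r • b + y}` and the functional `(u, r) ↦ c u - d * r` on `U × ℝ`; passing
to this larger space avoids checking that the functional is well defined on the range of `A`. -/
theorem exists_nonneg_linearMap_of_isGLB {U F : Type*} [AddCommGroup U] [Module ℝ U]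
    [AddCommGroup F] [PartialOrder F] [IsOrderedAddMonoid F] [Module ℝ F] [PosSMulMono ℝ F]
    (A : U →ₗ[ℝ] F) (b : F) (c : U →ₗ[ℝ] ℝ) (d : ℝ)
    (hd : IsGLB (c '' {u | b ≤ A u}) d) (hA : ∀ y, ∃ u, y ≤ A u) :
    ∃ φ : F →ₗ[ℝ] ℝ, (∀ y, 0 ≤ y → 0 ≤ φ y) ∧ (∀ u, φ (A u) = c u) ∧ φ b = d := by
  have hlb : ∀ u, b ≤ A u → d ≤ c u := fun u hu => hd.1 ⟨u, hu, rfl⟩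
  -- otherwise moving from a feasible point along `u` would make `c` unbounded below
  have hzero : ∀ u, 0 ≤ A u → 0 ≤ c u := by
    intro u hu
    obtain ⟨u₀, hu₀⟩ := hA b
    by_contra! hneg
    obtain ⟨N, hN⟩ := exists_nat_gt ((c u₀ - d) / (-c u))
    have h1 := hlb (u₀ + (N : ℝ) • u) (by
      rw [map_add, map_smul]
      exact le_add_of_le_of_nonneg hu₀ (smul_nonneg N.cast_nonneg hu))
    rw [div_lt_iff₀ (by linarith)] at hN
    simp only [map_add, map_smul, smul_eq_mul] at h1
    linarith
  have hpos : ∀ u (r : ℝ), r • b ≤ A u → r * d ≤ c u := by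
    intro u r hr
    rcases lt_trichotomy r 0 with h | h | h
    · -- adding `1 - r` copies of a feasible point gives a feasible point
      have key : ∀ u₀, b ≤ A u₀ → (d - c u) / (1 - r) ≤ c u₀ := by
        intro u₀ hu₀
        have h1 := hlb (u + (1 - r) • u₀) (by
          rw [map_add, map_smul]
          calc b = r • b + (1 - r) • b := by rw [← add_smul]; simp
            _ ≤ _ := add_le_add hr (smul_le_smul_of_nonneg_left hu₀ (by linarith)))
        simp only [map_add, map_smul, smul_eq_mul] at h1
        rw [div_le_iff₀ (by linarith)]
        linarith
      have h2 : (d - c u) / (1 - r) ≤ d :=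
        hd.2 (by rintro _ ⟨u₀, hu₀, rfl⟩; exact key u₀ hu₀)
      rw [div_le_iff₀ (by linarith)] at h2
      linarith
    · subst h
      simpa using hzero u (by simpa using hr)
    · have h1 := hlb (r⁻¹ • u) (by
        rw [map_smul]
        calc b = r⁻¹ • r • b := by rw [smul_smul, inv_mul_cancel₀ h.ne', one_smul]
          _ ≤ _ := smul_le_smul_of_nonneg_left hr (by positivity))
      rw [map_smul, smul_eq_mul, inv_mul_eq_div, le_div_iff₀ h] at h1
      linarith
  let L : (U × ℝ) × F →ₗ[ℝ] F :=
    (A.coprod (-(LinearMap.toSpanSingleton ℝ F b))).coprod LinearMap.id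
  have hL : ∀ u r y, L ((u, r), y) = A u - r • b + y := by
    intro u r y; simp [L, sub_eq_add_neg]
  let s : PointedCone ℝ ((U × ℝ) × F) :=
    { carrier := {z | 0 ≤ L z}
      add_mem' := fun {x y} hx hy => by
        change 0 ≤ L (x + y)
        rw [map_add]
        exact add_nonneg hx hy
      zero_mem' := L.map_zero.ge
      smul_mem' := fun r z (hz : 0 ≤ L z) => by
        change 0 ≤ L (r.1 • z)
        rw [map_smul]
        exact smul_nonneg r.2 hz }
  have hs : ∀ z, z ∈ s ↔ 0 ≤ L z := fun z => Iff.rfl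
  let f : ((U × ℝ) × F) →ₗ.[ℝ] ℝ :=
    { domain := (⊤ : Submodule ℝ (U × ℝ)).prod ⊥
      toFun := ((c.coprod (-(d • LinearMap.id))).comp (LinearMap.fst ℝ (U × ℝ) F)).comp
        (Submodule.subtype _) }
  have hf : ∀ (x : f.domain), f x = c x.1.1.1 - d * x.1.1.2 := by
    intro x
    change (c.coprod (-(d • LinearMap.id))) x.1.1 = _
    simp [sub_eq_add_neg]
  obtain ⟨g, hgf, hg⟩ := riesz_extension s f
    (by
      rintro ⟨⟨⟨u, r⟩, y⟩, hx⟩ hxs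
      obtain rfl : y = 0 := hx.2
      rw [hs, hL, add_zero, sub_nonneg] at hxs
      rw [hf, sub_nonneg]
      simpa [mul_comm] using hpos u r hxs)
    (by
      rintro ⟨⟨u, r⟩, y⟩
      obtain ⟨u', hu'⟩ := hA (-L ((u, r), y))
      refine ⟨⟨((u', 0), 0), ⟨trivial, rfl⟩⟩, ?_⟩
      rw [hs, map_add, hL u' 0 0]
      simpa using neg_le_iff_add_nonneg.1 hu')
  have hgf' : ∀ u r, g ((u, r), 0) = c u - d * r := by
    intro u r
    have := hgf ⟨((u, r), 0), ⟨trivial, rfl⟩⟩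
    rw [this, hf]
  -- `g` vanishes on the kernel of `L`, since both an element and its negative lie in the cone
  have hker : ∀ z, L z = 0 → g z = 0 := by
    intro z hz
    have h1 := hg z ((hs z).2 hz.ge)
    have h2 := hg (-z) ((hs _).2 (by simp [hz]))
    rw [map_neg] at h2
    linarith
  have hsplit : ∀ u r, g (0, A u - r • b) = c u - d * r := by
    intro u r
    have h1 := hker ((u, r), -(A u - r • b)) (by rw [hL]; simp)
    have h2 : (((u, r), -(A u - r • b)) : (U × ℝ) × F) = ((u, r), 0) - (0, A u - r • b) := by
      ext <;> simp
    rw [h2, map_sub, hgf'] at h1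
    linarith
  refine ⟨g.comp (LinearMap.inr ℝ (U × ℝ) F), fun y hy => hg _ ((hs _).2 ?_), fun u => ?_, ?_⟩
  · simpa [L] using hy
  · simpa using hsplit u 0
  · simpa using hsplit 0 (-1)

/-! ### Measures supported in a compact set -/

/-- The Riesz-Markov-Kakutani theorem on a compact subset `K`, with the representing measure pushed
forward to the ambient space. -/
theorem exists_isNonnegMeasureOn_integral_eq {α : Type*} [TopologicalSpace α] [T2Space α]
    [MeasurableSpace α] [BorelSpace α] {K : Set α} (hK : IsCompact K)
    (φ : C(K, ℝ) →ₗ[ℝ] ℝ) (hφ : ∀ f, 0 ≤ f → 0 ≤ φ f) :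
    ∃ μ : Measure α, IsNonnegMeasureOn K μ ∧
      ∀ (f : C(K, ℝ)) (g : α → ℝ), (∀ x : K, g x = f x) → ∫ x, g x ∂μ = φ f := by
  have := isCompact_iff_compactSpace.1 hK
  let ψ : C_c(K, ℝ) →ₗ[ℝ] ℝ :=
    { toFun := fun f => φ f.toContinuousMap
      map_add' := fun f g => φ.map_add f.toContinuousMap g.toContinuousMap
      map_smul' := fun r f => φ.map_smul r f.toContinuousMap }
  let Λ : C_c(K, ℝ) →ₚ[ℝ] ℝ := PositiveLinearMap.mk₀ ψ fun f hf => hφ _ hf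
  let ν := RealRMK.rieszMeasure Λ
  have hemb : MeasurableEmbedding (Subtype.val : K → α) :=
    MeasurableEmbedding.subtype_coe hK.measurableSet
  have : IsFiniteMeasure ν := ⟨isCompact_univ.measure_lt_top⟩
  refine ⟨ν.map Subtype.val, ⟨inferInstance, ?_⟩, fun f g hg => ?_⟩
  · refine Measure.support_subset_of_isClosed hK.isClosed ?_
    rw [mem_ae_iff, hemb.map_apply]
    simp
  · rw [hemb.integral_map]
    simp_rw [hg]
    exact RealRMK.integral_rieszMeasure Λ (CompactlySupportedContinuousMap.continuousMapEquiv f)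

theorem IsNonnegMeasureOn.measure_compl {α : Type*} [TopologicalSpace α]
    [HereditarilyLindelofSpace α] [MeasurableSpace α] {K : Set α} {μ : Measure α}
    (h : IsNonnegMeasureOn K μ) : μ Kᶜ = 0 :=
  measure_mono_null (compl_subset_compl.2 h.2) Measure.measure_compl_support

theorem IsNonnegMeasureOn.ae_mem {α : Type*} [TopologicalSpace α]
    [HereditarilyLindelofSpace α] [MeasurableSpace α] {K : Set α} {μ : Measure α}
    (h : IsNonnegMeasureOn K μ) : ∀ᵐ x ∂μ, x ∈ K :=
  mem_ae_iff.2 h.measure_compl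

theorem IsNonnegMeasureOn.restrict_eq {α : Type*} [TopologicalSpace α]
    [HereditarilyLindelofSpace α] [MeasurableSpace α] {K : Set α} {μ : Measure α}
    (h : IsNonnegMeasureOn K μ) : μ.restrict K = μ :=
  Measure.restrict_eq_self_of_ae_mem h.ae_mem

theorem IsNonnegMeasureOn.integrable {α : Type*} [TopologicalSpace α] [T2Space α]
    [HereditarilyLindelofSpace α] [MeasurableSpace α] [OpensMeasurableSpace α] {K : Set α}
    {μ : Measure α} (h : IsNonnegMeasureOn K μ) (hK : IsCompact K) {g : α → ℝ}
    (hg : ContinuousOn g K) : Integrable g μ := by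
  have := h.1
  have h1 := hg.integrableOn_of_subset_isCompact hK hK.measurableSet subset_rfl (μ := μ)
    (measure_ne_top _ _)
  rwa [IntegrableOn, h.restrict_eq] at h1

theorem IsNonnegMeasureOn.integral_nonneg {α : Type*} [TopologicalSpace α]
    [HereditarilyLindelofSpace α] [MeasurableSpace α] {K : Set α}
    {μ : Measure α} (h : IsNonnegMeasureOn K μ) {g : α → ℝ}
    (hg : ∀ x ∈ K, 0 ≤ g x) : 0 ≤ ∫ x, g x ∂μ := by
  refine integral_nonneg_of_ae ?_
  filter_upwards [h.ae_mem] with x hx using hg x hx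

/-! ### Zero sets of polynomials -/

/-- The zero set of a polynomial that does not vanish at `x₀` is Lebesgue null. By Fubini, the
null intersections with the lines through `x₀` show that almost every dilate of the zero set about
`x₀` is null, and all the dilates have proportional measures. -/
theorem volume_mvPolynomial_zeroSet {n : ℕ} {p : MvPolynomial (Fin n) ℝ}
    {x₀ : EuclideanSpace ℝ (Fin n)} (hx₀ : MvPolynomial.eval (fun j => x₀ j) p ≠ 0) :
    volume {x : EuclideanSpace ℝ (Fin n) | MvPolynomial.eval (fun j => x j) p = 0} = 0 := by
  set Z := {x : EuclideanSpace ℝ (Fin n) | MvPolynomial.eval (fun j => x j) p = 0}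
  have hcont : Continuous fun x : EuclideanSpace ℝ (Fin n) =>
      MvPolynomial.eval (fun j => x j) p :=
    (MvPolynomial.continuous_eval p).comp (by fun_prop)
  have hZ : IsClosed Z := isClosed_singleton.preimage hcont
  let S : Set (EuclideanSpace ℝ (Fin n) × ℝ) := {q | x₀ + q.2 • q.1 ∈ Z}
  have hS : MeasurableSet S := (hZ.preimage (by fun_prop)).measurableSet
  -- a line through `x₀` meets the zero set in finitely many points
  have hline : ∀ x : EuclideanSpace ℝ (Fin n), volume (Prod.mk x ⁻¹' S) = 0 := by
    intro x
    let q : Polynomial ℝ := MvPolynomial.aeval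
      (fun i => Polynomial.C (x₀ i) + Polynomial.X * Polynomial.C (x i)) p
    have hq : ∀ t : ℝ, q.eval t = MvPolynomial.eval (fun j => (x₀ + t • x) j) p := by
      intro t
      change Polynomial.evalRingHom t (MvPolynomial.aeval _ p) = _
      rw [MvPolynomial.map_aeval]
      simp only [MvPolynomial.eval, MvPolynomial.coe_eval₂Hom]
      congr 1
      · ext; simp
      · ext i; simp [mul_comm t]
    have hq0 : q ≠ 0 := by
      intro h
      apply hx₀
      have := hq 0
      simpa [h] using this.symm
    have : Prod.mk x ⁻¹' S = {t | q.IsRoot t} := by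
      ext t
      simp only [S, Z, mem_preimage, mem_ofPred_eq, Polynomial.IsRoot.def, hq]
    rw [this]
    exact (Polynomial.finite_setOfPred_isRoot hq0).measure_zero _
  have hnull : (volume.prod volume) S = 0 :=
    (Measure.measure_prod_null hS).2 (Filter.Eventually.of_forall hline)
  have hslice : ∀ᵐ t : ℝ, volume ((fun x => (x, t)) ⁻¹' S) = 0 := by
    have := Measure.measure_ae_null_of_prod_null
      (μ := (volume : Measure ℝ)) (ν := (volume : Measure (EuclideanSpace ℝ (Fin n))))
      (s := Prod.swap ⁻¹' S) (by
        rw [← Measure.map_apply measurable_swap hS, Measure.prod_swap, hnull])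
    exact this
  obtain ⟨t, ht, ht0⟩ := (hslice.and (Measure.ae_ne volume (0 : ℝ))).exists
  have hpre : (fun x => (x, t)) ⁻¹' S = (t • ·) ⁻¹' ((x₀ + ·) ⁻¹' Z) := rfl
  rw [hpre, Measure.addHaar_preimage_smul _ ht0, measure_preimage_add] at ht
  simpa [ht0] using ht

/-! ### The Liouville operator and the constraint sets -/

namespace ROAData

variable {n : ℕ} (P : ROAData n)

theorem continuous_field : Continuous fun p : ℝ × EuclideanSpace ℝ (Fin n) =>
    P.field p.1 p.2 := by
  refine (PiLp.continuous_toLp 2 _).comp (continuous_pi fun i => ?_)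
  refine (MvPolynomial.continuous_eval (P.f i)).comp (continuous_pi fun j => ?_)
  refine Fin.cases ?_ (fun k => ?_) j
  · simpa using continuous_fst
  · simp only [Fin.cons_succ]
    fun_prop

theorem continuous_liouville {v : ℝ × EuclideanSpace ℝ (Fin n) → ℝ} (hv : ContDiff ℝ 1 v) :
    Continuous (P.liouville v) := by
  have h := hv.continuous_fderiv one_ne_zero
  exact (h.clm_apply continuous_const).add
    (h.clm_apply (continuous_const.prodMk P.continuous_field))

theorem liouville_add {v v' : ℝ × EuclideanSpace ℝ (Fin n) → ℝ} (hv : ContDiff ℝ 1 v)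
    (hv' : ContDiff ℝ 1 v') (p) : P.liouville (v + v') p = P.liouville v p + P.liouville v' p := by
  simp only [liouville]
  rw [fderiv_add (hv.differentiable one_ne_zero p) (hv'.differentiable one_ne_zero p)]
  simp only [add_apply]
  ring

theorem liouville_smul {v : ℝ × EuclideanSpace ℝ (Fin n) → ℝ} (hv : ContDiff ℝ 1 v)
    (r : ℝ) (p) : P.liouville (r • v) p = r * P.liouville v p := by
  simp only [liouville]
  rw [fderiv_const_smul (hv.differentiable one_ne_zero p)]
  simp only [smul_apply, smul_eq_mul]
  ring

theorem continuous_eval_gX : Continuous fun x : EuclideanSpace ℝ (Fin n) =>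
    MvPolynomial.eval (fun j => x j) P.gX :=
  (MvPolynomial.continuous_eval P.gX).comp (by fun_prop)

theorem continuous_eval_gT : Continuous fun x : EuclideanSpace ℝ (Fin n) =>
    MvPolynomial.eval (fun j => x j) P.gT :=
  (MvPolynomial.continuous_eval P.gT).comp (by fun_prop)

variable {P}

theorem isCompact_Xbdry (h : IsCompact P.Xbar) : IsCompact P.Xbdry :=
  h.of_isClosed_subset (isClosed_singleton.preimage P.continuous_eval_gX)
    fun _ hx => (show _ = _ from hx).ge

theorem isCompact_XTc (h : IsCompact P.Xbar) : IsCompact P.XTc :=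
  h.inter_right (isClosed_Iic.preimage P.continuous_eval_gT)

/-- `Xbar` and `X` differ by the zero set of `g_X`, which is null as soon as `X` is nonempty. -/
theorem setIntegral_X_eq (hX : P.X.Nonempty) (w : EuclideanSpace ℝ (Fin n) → ℝ) :
    ∫ x in P.X, w x = ∫ x in P.Xbar, w x := by
  obtain ⟨x₀, hx₀⟩ := hX
  refine setIntegral_congr_set ?_
  have hpos : 0 < MvPolynomial.eval (fun j => x₀ j) P.gX := hx₀
  have h0 := volume_mvPolynomial_zeroSet hpos.ne'
  have h1 : ∀ᵐ x : EuclideanSpace ℝ (Fin n), MvPolynomial.eval (fun j => x j) P.gX ≠ 0 := by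
    simpa [ae_iff] using h0
  filter_upwards [h1] with x hx
  exact propext ⟨fun h => le_of_lt (show 0 < MvPolynomial.eval (fun j => x j) P.gX from h),
    fun h => lt_of_le_of_ne h hx.symm⟩

/-! ### Weak duality -/

theorem weak_duality (hcompact : IsCompact P.Xbar) {μ₀ μ μT1 μT2 μhat₀}
    (hμ : P.PrimalFeasible μ₀ μ μT1 μT2 μhat₀) {v w} (hvw : P.DualFeasible v w) :
    ∫ _x, (1 : ℝ) ∂μ₀ ≤ ∫ x in P.Xbar, w x := by
  have hv0 : Continuous fun x : EuclideanSpace ℝ (Fin n) => v (0, x) :=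
    hvw.contDiff.continuous.comp (by fun_prop)
  have hw := hμ.initial.integrable hcompact hvw.continuousOn
  have hv := hμ.initial.integrable hcompact hv0.continuousOn
  have := hμ.initial.1
  have e1 : 0 ≤ ∫ x, (w x - v (0, x) - 1) ∂μ₀ :=
    hμ.initial.integral_nonneg fun x hx => by linarith [hvw.initial x hx]
  have e1' := integral_sub (hw.sub hv) (integrable_const (1 : ℝ))
  simp only [Pi.sub_apply] at e1'
  rw [e1', integral_sub hw hv] at e1
  have e2 : 0 ≤ ∫ p, -P.liouville v p ∂μ := hμ.occupation.integral_nonneg fun p hp =>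
    neg_nonneg.2 (hvw.liouville_nonpos p.1 hp.1 p.2 hp.2)
  rw [integral_neg] at e2
  have e3 : 0 ≤ ∫ p, v p ∂μT1 := hμ.final₁.integral_nonneg fun p hp =>
    hvw.final₁ p.1 hp.1 p.2 hp.2
  have e4 : 0 ≤ ∫ x, v (P.T, x) ∂μT2 := hμ.final₂.integral_nonneg hvw.final₂
  have e5 : 0 ≤ ∫ x, w x ∂μhat₀ := hμ.slack.integral_nonneg hvw.nonneg
  have e6 := hμ.liouville_eq v hvw.contDiff
  have e7 := hμ.domination w hvw.continuousOn
  rw [hμ.initial.restrict_eq, hμ.slack.restrict_eq] at e7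
  linarith

variable (P)

/-! ### The dual program in conic form -/

/-- The space of `C¹` functions on `ℝ × ℝⁿ`. -/
def contDiffSubmodule (n : ℕ) : Submodule ℝ (ℝ × EuclideanSpace ℝ (Fin n) → ℝ) where
  carrier := {v | ContDiff ℝ 1 v}
  add_mem' := fun {v v'} (h : ContDiff ℝ 1 v) (h' : ContDiff ℝ 1 v') => h.add h'
  zero_mem' := (contDiff_const : ContDiff ℝ 1 fun _ => (0 : ℝ))
  smul_mem' := fun _ v (h : ContDiff ℝ 1 v) => contDiff_const.smul h

/-- The space of functions on `ℝⁿ` that are continuous on `Xbar`. -/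
def continuousOnSubmodule : Submodule ℝ (EuclideanSpace ℝ (Fin n) → ℝ) where
  carrier := {w | ContinuousOn w P.Xbar}
  add_mem' := fun {w w'} (h : ContinuousOn w P.Xbar) (h' : ContinuousOn w' P.Xbar) => h.add h'
  zero_mem' := (continuousOn_const : ContinuousOn (fun _ => (0 : ℝ)) P.Xbar)
  smul_mem' := fun _ w (h : ContinuousOn w P.Xbar) => continuousOn_const.smul h

theorem contDiff_coe (v : contDiffSubmodule n) : ContDiff ℝ 1 v.1 := v.2

variable {P} in
theorem continuous_coe_Xbar (w : P.continuousOnSubmodule) : Continuous fun x : P.Xbar => w.1 x :=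
  continuousOn_iff_continuous_domRestrict.1 w.2

/-- The linear part `A` of the constraints of the dual program: `(v, w)` is feasible if and only if
`(0, 1, 0, 0, 0) ≤ A (v, w)`. The components are ordered as the measures `μ`, `μ₀`, `μ_T²`, `μ_T¹`,
`μ̂₀` that are dual to them. -/
noncomputable def constraintMap : contDiffSubmodule n × P.continuousOnSubmodule →ₗ[ℝ]
    C(Icc 0 P.T ×ˢ P.Xbar, ℝ) × C(P.Xbar, ℝ) × C(P.XTc, ℝ) ×
      C(Icc 0 P.T ×ˢ P.Xbdry, ℝ) × C(P.Xbar, ℝ) where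
  toFun u :=
    (⟨fun p => -P.liouville u.1.1 p,
      (P.continuous_liouville u.1.2).neg.comp continuous_subtype_val⟩,
    ⟨fun x => u.2.1 x - u.1.1 (0, x), (continuous_coe_Xbar u.2).sub
      ((contDiff_coe u.1).continuous.comp (by fun_prop))⟩,
    ⟨fun x => u.1.1 (P.T, x), (contDiff_coe u.1).continuous.comp (by fun_prop)⟩,
    ⟨fun p => u.1.1 p, (contDiff_coe u.1).continuous.comp continuous_subtype_val⟩,
    ⟨fun x => u.2.1 x, continuous_coe_Xbar u.2⟩)
  map_add' u u' := by
    ext p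
    · simp [P.liouville_add u.1.2 u'.1.2]; ring
    · simp; ring
    all_goals simp
  map_smul' r u := by
    ext p
    · simp [P.liouville_smul u.1.2]
    · simp; ring
    all_goals simp

theorem le_constraintMap_iff (u : contDiffSubmodule n × P.continuousOnSubmodule) :
    (0, 1, 0, 0, 0) ≤ P.constraintMap u ↔ P.DualFeasible u.1.1 u.2.1 := by
  simp only [constraintMap, LinearMap.coe_mk, AddHom.coe_mk, Prod.mk_le_mk, ContinuousMap.le_def]
  constructor
  · rintro ⟨h1, h2, h3, h4, h5⟩
    exact ⟨u.1.2, u.2.2, fun t ht x hx => neg_nonneg.1 (h1 ⟨(t, x), ht, hx⟩),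
      fun x hx => by have := h2 ⟨x, hx⟩; simp at this; linarith,
      fun x hx => h3 ⟨x, hx⟩, fun t ht x hx => h4 ⟨(t, x), ht, hx⟩, fun x hx => h5 ⟨x, hx⟩⟩
  · intro h
    exact ⟨fun p => neg_nonneg.2 (h.liouville_nonpos _ p.2.1 _ p.2.2),
      fun x => by have := h.initial x x.2; simp; linarith,
      fun x => h.final₂ x x.2, fun p => h.final₁ _ p.2.1 _ p.2.2, fun x => h.nonneg x x.2⟩

variable {P}

/-- The Slater condition. It is witnessed by `v = M (T + 1 - t)` and `w = M (T + 2)` for a bound `M`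
on the given functions. -/
theorem exists_le_constraintMap (hT : 0 < P.T) (hcompact : IsCompact P.Xbar) (y) :
    ∃ u, y ≤ P.constraintMap u := by
  have := isCompact_iff_compactSpace.1 hcompact
  have := isCompact_iff_compactSpace.1 (isCompact_XTc hcompact)
  have := isCompact_iff_compactSpace.1 (isCompact_Icc (a := 0) (b := P.T) |>.prod hcompact)
  have := isCompact_iff_compactSpace.1
    (isCompact_Icc (a := 0) (b := P.T) |>.prod (isCompact_Xbdry hcompact))
  obtain ⟨y1, y2, y3, y4, y5⟩ := y
  obtain ⟨M, hM0, hM1, hM2, hM3, hM4, hM5⟩ : ∃ M : ℝ, 0 ≤ M ∧ ‖y1‖ ≤ M ∧ ‖y2‖ ≤ M ∧ ‖y3‖ ≤ M ∧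
      ‖y4‖ ≤ M ∧ ‖y5‖ ≤ M := by
    refine ⟨‖y1‖ + ‖y2‖ + ‖y3‖ + ‖y4‖ + ‖y5‖, by positivity, ?_⟩
    have := norm_nonneg y1
    have := norm_nonneg y2
    have := norm_nonneg y3
    have := norm_nonneg y4
    have := norm_nonneg y5
    refine ⟨?_, ?_, ?_, ?_, ?_⟩ <;> linarith
  let v : ℝ × EuclideanSpace ℝ (Fin n) → ℝ := fun p => M * (P.T + 1 - p.1)
  have hv : ContDiff ℝ 1 v := contDiff_const.mul (contDiff_const.sub contDiff_fst)
  have hLv : ∀ p, P.liouville v p = -M := by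
    intro p
    have h : HasFDerivAt v (M • (0 - ContinuousLinearMap.fst ℝ ℝ (EuclideanSpace ℝ (Fin n)))) p :=
      ((hasFDerivAt_const _ _).sub hasFDerivAt_fst).const_mul M
    simp [liouville, h.fderiv]
  refine ⟨(⟨v, hv⟩, ⟨fun _ => M * (P.T + 2), continuousOn_const⟩), ?_⟩
  simp only [constraintMap, LinearMap.coe_mk, AddHom.coe_mk, Prod.mk_le_mk, ContinuousMap.le_def]
  have hMT : 0 ≤ M * P.T := mul_nonneg hM0 hT.le
  refine ⟨fun p => ?_, fun x => ?_, fun x => ?_, fun p => ?_, fun x => ?_⟩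
  · have := (y1.apply_le_norm p).trans hM1
    simpa [hLv] using this
  · have := (y2.apply_le_norm x).trans hM2
    simp [v]; linarith
  · have := (y3.apply_le_norm x).trans hM3
    simp [v]; linarith
  · have := (y4.apply_le_norm p).trans hM4
    have := mul_nonneg hM0 (sub_nonneg.2 p.2.1.2)
    simp [v]; linarith
  · have := (y5.apply_le_norm x).trans hM5
    simp; linarith

/-! ### Strong duality -/

/-- The primal program attains the infimum of the dual program. -/
theorem exists_primalFeasible (hT : 0 < P.T) (hcompact : IsCompact P.Xbar) {d : ℝ}
    (hd : IsGLB {r : ℝ | ∃ v w, P.DualFeasible v w ∧ r = ∫ x in P.Xbar, w x} d) :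
    ∃ μ₀ μ μT1 μT2 μhat₀, P.PrimalFeasible μ₀ μ μT1 μT2 μhat₀ ∧ ∫ _x, (1 : ℝ) ∂μ₀ = d := by
  have hint : ∀ w : P.continuousOnSubmodule, IntegrableOn w.1 P.Xbar :=
    fun w => ContinuousOn.integrableOn_compact hcompact w.2
  let c : contDiffSubmodule n × P.continuousOnSubmodule →ₗ[ℝ] ℝ :=
    { toFun := fun u => ∫ x in P.Xbar, u.2.1 x
      map_add' := fun u u' => integral_add (hint u.2) (hint u'.2)
      map_smul' := fun r u => integral_const_mul r _ }
  obtain ⟨φ, hφ, hφA, hφb⟩ := exists_nonneg_linearMap_of_isGLB P.constraintMap (0, 1, 0, 0, 0) c d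
    (by
      convert hd using 1
      ext r
      constructor
      · rintro ⟨u, hu, rfl⟩
        exact ⟨u.1.1, u.2.1, (P.le_constraintMap_iff u).1 hu, rfl⟩
      · rintro ⟨v, w, hvw, rfl⟩
        exact ⟨(⟨v, hvw.contDiff⟩, ⟨w, hvw.continuousOn⟩), (P.le_constraintMap_iff _).2 hvw, rfl⟩)
    (exists_le_constraintMap hT hcompact)
  obtain ⟨μ, hμ, hμi⟩ := exists_isNonnegMeasureOn_integral_eq
    (isCompact_Icc.prod hcompact) (φ ∘ₗ LinearMap.inl ℝ _ _)
    fun f hf => hφ _ (by simpa [Prod.le_def] using hf)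
  obtain ⟨μ₀, hμ₀, hμ₀i⟩ := exists_isNonnegMeasureOn_integral_eq hcompact
    (φ ∘ₗ LinearMap.inr ℝ _ _ ∘ₗ LinearMap.inl ℝ _ _)
    fun f hf => hφ _ (by simpa [Prod.le_def] using hf)
  obtain ⟨μT2, hμT2, hμT2i⟩ := exists_isNonnegMeasureOn_integral_eq (isCompact_XTc hcompact)
    (φ ∘ₗ LinearMap.inr ℝ _ _ ∘ₗ LinearMap.inr ℝ _ _ ∘ₗ LinearMap.inl ℝ _ _)
    fun f hf => hφ _ (by simpa [Prod.le_def] using hf)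
  obtain ⟨μT1, hμT1, hμT1i⟩ := exists_isNonnegMeasureOn_integral_eq
    (isCompact_Icc.prod (isCompact_Xbdry hcompact))
    (φ ∘ₗ LinearMap.inr ℝ _ _ ∘ₗ LinearMap.inr ℝ _ _ ∘ₗ LinearMap.inr ℝ _ _ ∘ₗ
      LinearMap.inl ℝ _ _)
    fun f hf => hφ _ (by simpa [Prod.le_def] using hf)
  obtain ⟨μhat₀, hμhat₀, hμhat₀i⟩ := exists_isNonnegMeasureOn_integral_eq hcompact
    (φ ∘ₗ LinearMap.inr ℝ _ _ ∘ₗ LinearMap.inr ℝ _ _ ∘ₗ LinearMap.inr ℝ _ _ ∘ₗ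
      LinearMap.inr ℝ _ _)
    fun f hf => hφ _ (by simpa [Prod.le_def] using hf)
  have hsum : ∀ y, φ y = φ (y.1, 0, 0, 0, 0) + φ (0, y.2.1, 0, 0, 0) +
      φ (0, 0, y.2.2.1, 0, 0) + φ (0, 0, 0, y.2.2.2.1, 0) + φ (0, 0, 0, 0, y.2.2.2.2) := by
    intro y
    simp only [← map_add]
    congr 1
    simp
  refine ⟨μ₀, μ, μT1, μT2, μhat₀, ⟨hμ₀, hμ, hμT1, hμT2, hμhat₀, fun v hv => ?_, fun w hw => ?_⟩, ?_⟩
  · -- the Liouville equation is `φ (A (v, 0)) = 0`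
    let A := P.constraintMap (⟨v, hv⟩, 0)
    have h0 : φ A = 0 := by rw [hφA]; simp [c]
    have e1 : ∫ p, -P.liouville v p ∂μ = φ (A.1, 0, 0, 0, 0) := hμi A.1 _ fun _ => rfl
    have e2 : ∫ x, -v (0, x) ∂μ₀ = φ (0, A.2.1, 0, 0, 0) :=
      hμ₀i A.2.1 _ fun _ => by simp [A, constraintMap]
    have e3 : ∫ x, v (P.T, x) ∂μT2 = φ (0, 0, A.2.2.1, 0, 0) := hμT2i A.2.2.1 _ fun _ => rfl
    have e4 : ∫ p, v p ∂μT1 = φ (0, 0, 0, A.2.2.2.1, 0) := hμT1i A.2.2.2.1 _ fun _ => rfl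
    have e5 : A.2.2.2.2 = 0 := by ext; simp [A, constraintMap]
    rw [hsum, e5] at h0
    rw [integral_neg] at e1 e2
    have e6 : φ (0, 0, 0, 0, 0) = 0 := φ.map_zero
    linarith
  · -- the domination constraint is `φ (A (0, w)) = ∫ w`
    let A := P.constraintMap (0, ⟨w, hw⟩)
    have h0 : φ A = ∫ x in P.Xbar, w x := hφA _
    have e1 : A.1 = 0 := by
      ext p
      simp [A, constraintMap, liouville]
    have e2 : ∫ x, w x ∂μ₀ = φ (0, A.2.1, 0, 0, 0) :=
      hμ₀i A.2.1 _ fun _ => by simp [A, constraintMap]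
    have e3 : A.2.2.1 = 0 := by ext; simp [A, constraintMap]
    have e4 : A.2.2.2.1 = 0 := by ext; simp [A, constraintMap]
    have e5 : ∫ x, w x ∂μhat₀ = φ (0, 0, 0, 0, A.2.2.2.2) := hμhat₀i A.2.2.2.2 _ fun _ => rfl
    rw [hsum, e1, e3, e4] at h0
    have e6 : φ (0, 0, 0, 0, 0) = 0 := φ.map_zero
    rw [hμ₀.restrict_eq, hμhat₀.restrict_eq]
    linarith
  · -- the value is the mass of `μ₀`, which is `φ (0, 1, 0, 0, 0) = d`
    rw [← hφb]
    exact hμ₀i 1 (fun _ => 1) fun _ => rfl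

end ROAData

theorem mainTheorem4 {n : ℕ} (P : ROAData n) (hT : 0 < P.T) (hX : P.X.Nonempty)
    (hcompact : IsCompact P.Xbar) (hXT : P.XT ⊆ P.X) :
    P.primalValue = P.dualValue := by
  let D : Set ℝ := {r | ∃ v w, P.DualFeasible v w ∧ r = ∫ x in P.Xbar, w x}
  have hne : D.Nonempty := by
    obtain ⟨u, hu⟩ := ROAData.exists_le_constraintMap hT hcompact (0, 1, 0, 0, 0)
    exact ⟨_, _, _, (P.le_constraintMap_iff u).1 hu, rfl⟩
  have hbdd : BddBelow D := by
    refine ⟨0, ?_⟩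
    rintro _ ⟨v, w, hvw, rfl⟩
    exact setIntegral_nonneg hcompact.measurableSet hvw.nonneg
  have hd := isGLB_csInf hne hbdd
  apply le_antisymm
  · unfold ROAData.primalValue ROAData.dualValue
    refine sSup_le ?_
    rintro _ ⟨μ₀, μ, μT1, μT2, μhat₀, hμ, rfl⟩
    refine le_sInf ?_
    rintro _ ⟨v, w, hvw, rfl⟩
    rw [ROAData.setIntegral_X_eq hX]
    exact EReal.coe_le_coe_iff.2 (ROAData.weak_duality hcompact hμ hvw)
  · obtain ⟨μ₀, μ, μT1, μT2, μhat₀, hμ, hval⟩ := ROAData.exists_primalFeasible hT hcompact hd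
    refine le_trans ?_ (le_sSup ⟨μ₀, μ, μT1, μT2, μhat₀, hμ, rfl⟩)
    rw [hval]
    refine EReal.le_of_forall_lt_iff_le.1 fun r hr => ?_
    obtain ⟨_, ⟨v, w, hvw, rfl⟩, hlt⟩ := exists_lt_of_csInf_lt hne (EReal.coe_lt_coe_iff.1 hr)
    refine (sInf_le ⟨v, w, hvw, rfl⟩ : P.dualValue ≤ _).trans ?_
    rw [ROAData.setIntegral_X_eq hX]
    exact EReal.coe_le_coe_iff.2 hlt.le
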